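/- An infinite permutation $\alpha$ is an equivalence class of sequences $(a[n])_{n\ge 0}$ of pairwise distinct reals, where $(a[n])\sim(b[n])$ if for all $i,j$ the conditions $a[i]<a[j]$ and $b[i]<b[j]$ are equivalent; the members of the class are its representatives. Its complexity $p_\alpha(n)$ is the number of distinct factors of $\alpha$ of length $n$, that is, of finite permutations (order types) of $(a[i],\dots,a[i+n-1])$, $i\ge 0$. The permutation $\alpha$ is equidistributed if it has a representative $(a[n])$ with values in $[0,1]$ such that $\lim_{n\to\infty}\frac{1}{n}\#\{0\le i<n : a[i]<t\}=t$ for every $t\in[0,1]$. A Sturmian permutation is one that, for some irrational $\sigma$ and some real $\rho$, is represented by $(\{\rho+n\sigma\})_{n\ge 0}$, where $\{x\}=x-\lfloor x\rfloor$ (this permutation is denoted $\beta_{\sigma,\rho}$), or by $(\{\rho+n\sigma\}')_{n\ge 0}$, where $\{x\}'=x-\lceil x\rceil+1$ is the upper fractional part; the two differ only if $\rho+n\sigma\in\mathbb Z$ for some $n\ge 0$. Theorem. Every equidistributed infinite permutation $\alpha$ satisfies $p_\alpha(n)\ge n$ for all $n$, and there is an equidistributed infinite permutation with $p_\alpha(n)=n$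 for all $n\ge 1$. The set of equidistributed infinite permutations $\alpha$ with $p_\alpha(n)=n$ for all $n\ge 1$ coincides with the set of Sturmian permutations. -/

import Mathlib

open Filter Topology

/-- Sequences of pairwise distinct reals indexed by `ι`, up to order equivalence:
`a ∼ b` if for all `i, j` the conditions `a i < a j` and `b i < b j` are equivalent. -/
def orderEquivSetoid (ι : Type) : Setoid {a : ι → ℝ // Function.Injective a} where
  r a b := ∀ i j, a.1 i < a.1 j ↔ b.1 i < b.1 j
  iseqv :=
    ⟨fun _ _ _ => Iff.rfl, fun h i j => (h i j).symm, fun h h' i j => (h i j).trans (h' i j)⟩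

/-- Equivalence classes of `ι`-indexed families of pairwise distinct reals. -/
def OrderPattern (ι : Type) : Type := Quotient (orderEquivSetoid ι)

/-- An infinite permutation is an equivalence class of sequences of pairwise distinct reals. -/
abbrev InfinitePermutation : Type := OrderPattern ℕ

/-- A finite permutation of length `n`, given by the relative order of its `n` elements. -/
abbrev FinitePermutation (n : ℕ) : Type := OrderPattern (Fin n)

namespace OrderPattern

/-- The class of a family of pairwise distinct reals. -/
def mk {ι : Type} (a : ι → ℝ) (ha : Function.Injective a) : OrderPattern ι :=
  Quotient.mk (orderEquivSetoid ι) ⟨a, ha⟩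

/-- `a` is a representative of `α`. -/
def IsRepresentative {ι : Type} (α : OrderPattern ι) (a : ι → ℝ) : Prop :=
  ∃ ha : Function.Injective a, α = mk a ha

/-- Restriction of a pattern along an injective map of index sets. -/
def comap {ι κ : Type} (f : κ ↪ ι) : OrderPattern ι → OrderPattern κ :=
  Quotient.map (sa := orderEquivSetoid ι) (sb := orderEquivSetoid κ)
    (fun a => ⟨a.1 ∘ f, a.2.comp f.injective⟩) (fun _ _ h i j => h (f i) (f j))

theorem mk_eq_mk {ι : Type} {a b : ι → ℝ} (ha : Function.Injective a)
    (hb : Function.Injective b) :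
    mk a ha = mk b hb ↔ ∀ i j, a i < a j ↔ b i < b j :=
  Quotient.eq (r := orderEquivSetoid ι)

/-- The order between the elements of a pattern. -/
def lt {ι : Type} (α : OrderPattern ι) : ι → ι → Prop :=
  Quotient.lift (s := orderEquivSetoid ι) (fun a i j => a.1 i < a.1 j)
    (fun _ _ h => by funext i j; exact propext (h i j)) α

theorem lt_injective {ι : Type} : Function.Injective (lt (ι := ι)) := by
  intro α β h
  induction α using Quotient.inductionOn with | _ a =>
  induction β using Quotient.inductionOn with | _ b =>
  refine Quotient.sound (s := orderEquivSetoid ι) fun i j => ?_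
  exact iff_of_eq (congrFun (congrFun h i) j)

/-- There are only finitely many finite permutations of a given length. -/
instance {ι : Type} [Finite ι] : Finite (OrderPattern ι) :=
  Finite.of_injective _ lt_injective

end OrderPattern

namespace InfinitePermutation

/-- The factor `α[i..i+n-1]`, as a finite permutation. -/
def factor (α : InfinitePermutation) (i n : ℕ) : FinitePermutation n :=
  OrderPattern.comap ⟨fun k : Fin n => i + (k : ℕ), fun _ _ h => Fin.ext (Nat.add_left_cancel h)⟩ α

/-- The complexity `p_α(n)`: the number of factors of length `n` (a finite set). -/
noncomputable def complexity (α : InfinitePermutation) (n : ℕ) : ℕ :=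
  (Set.range fun i : ℕ => α.factor i n).ncard

end InfinitePermutation

/-- The sequence `x` of reals from `[a, b]` is equidistributed on `[a, b]`: for each
`t ∈ [a, b]`, the proportion of `i < n` with `x i < t` tends to `(t - a) / (b - a)`. -/
def IsEquidistributedSeq (a b : ℝ) (x : ℕ → ℝ) : Prop :=
  (∀ i, x i ∈ Set.Icc a b) ∧
    ∀ t ∈ Set.Icc a b,
      Tendsto (fun n : ℕ => (((Finset.range n).filter fun i => x i < t).card : ℝ) / (n : ℝ))
        atTop (𝓝 ((t - a) / (b - a)))

namespace InfinitePermutation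

/-- A permutation is equidistributed if it has a representative which is an equidistributed
sequence on `[0, 1]`. -/
def IsEquidistributed (α : InfinitePermutation) : Prop :=
  ∃ a : ℕ → ℝ, α.IsRepresentative a ∧ IsEquidistributedSeq 0 1 a

/-- The upper fractional part `x - ⌈x⌉ + 1`, with values in `(0, 1]`. -/
noncomputable def upperFract (x : ℝ) : ℝ := x - (⌈x⌉ : ℝ) + 1

theorem rotation_injective {σ : ℝ} (hσ : Irrational σ) (ρ : ℝ) {m n : ℕ} (k : ℤ)
    (h : (ρ + m * σ) - (ρ + n * σ) = k) : m = n := by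
  by_contra hmn
  have h0 : ((m : ℤ) - n : ℤ) ≠ 0 := by omega
  have h1 : Irrational ((((m : ℤ) - n : ℤ) : ℝ) * σ) := hσ.intCast_mul h0
  refine h1.ne_int k ?_
  push_cast
  linarith

theorem fract_rotation_injective {σ : ℝ} (hσ : Irrational σ) (ρ : ℝ) :
    Function.Injective fun n : ℕ => Int.fract (ρ + n * σ) := by
  intro m n h
  obtain ⟨k, hk⟩ := Int.fract_eq_fract.1 h
  exact rotation_injective hσ ρ k hk

theorem upperFract_rotation_injective {σ : ℝ} (hσ : Irrational σ) (ρ : ℝ) :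
    Function.Injective fun n : ℕ => upperFract (ρ + n * σ) := by
  intro m n h
  refine rotation_injective hσ ρ (⌈ρ + m * σ⌉ - ⌈ρ + n * σ⌉) ?_
  simp only [upperFract] at h
  push_cast
  linarith

/-- The permutation with representative `({ρ + nσ})`, for irrational `σ`. -/
noncomputable def lowerRotation (σ ρ : ℝ) (hσ : Irrational σ) : InfinitePermutation :=
  OrderPattern.mk (fun n : ℕ => Int.fract (ρ + n * σ)) (fract_rotation_injective hσ ρ)

/-- The permutation defined in the same way with the upper fractional part. It differs from
`lowerRotation σ ρ` only if `ρ + nσ` is an integer for some `n ≥ 0`. -/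
noncomputable def upperRotation (σ ρ : ℝ) (hσ : Irrational σ) : InfinitePermutation :=
  OrderPattern.mk (fun n : ℕ => upperFract (ρ + n * σ)) (upperFract_rotation_injective hσ ρ)

/-- Sturmian permutations: those of irrational rotations, with the lower or the upper
fractional part. -/
def IsSturmian (α : InfinitePermutation) : Prop :=
  ∃ (σ ρ : ℝ) (hσ : Irrational σ), α = lowerRotation σ ρ hσ ∨ α = upperRotation σ ρ hσ

end InfinitePermutation

/-!
Let `a` be an equidistributed representative. An interval visited at bounded gaps `L` has length at
least `1 / L`, so `a` is not monotone along any sequence of indices with bounded gaps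
(`IsEquidistributedSeq.noMonotoneChain`). Hence block maxima are not eventually monotone, there are
local maxima of every radius, and every position in a window of length `n` is the position of the
maximum of some window: there are at least `n` factors of length `n`.

If there are exactly `n` factors of every length `n`, the order of a window is determined by the
position of its maximum, and also by that of its minimum (`IsMinimal`). Comparing lengths `n` and
`n + 1` shows that two windows of the same order which are extended differently to the right are
extended by a new maximum and by a new minimum (`IsMinimal.right_special`). These two extensions
have the same *circular* order. By induction on `n`, all windows of length `n` have the same
circular order (`IsMinimal.cycInvariant`): otherwise there are windows of length `n + 1` in which
the first and the last element are circularly adjacent in either order, and following one suitable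
element from one return of a maximum to the next gives a monotone chain
(`IsMinimal.false_of_adjacent`). So the shift preserves the circular order of the values. Since the
frequency of visits to a circular interval is its length, the shift preserves differences modulo
`1`, so `a i ≡ a 0 + i (a 1 - a 0)` modulo `1`, which makes the permutation Sturmian; whether the
lower or the upper fractional part is needed depends on which end of `[0, 1]` occurs as a value.

Conversely, `{ρ + nσ}` visits `[0, {kσ})` with bounded discrepancy, by telescoping, and the numbers
`{kσ}` are dense, which gives equidistribution. The `n` points `{-jσ}`, `j < n`, cut the circle into
`n` arcs which determine the factors of length `n`, so there are at most `n` of them. The upper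
fractional part is the lower one of the opposite rotation with the order reversed.
-/

/-! ### Maxima of windows -/

/-- The windows of length `n` of `a` starting at `i` and at `j` are in the same relative order. -/
def SameOrder (a : ℕ → ℝ) (n i j : ℕ) : Prop :=
  ∀ p < n, ∀ q < n, a (i + p) < a (i + q) ↔ a (j + p) < a (j + q)

/-- The maximum of the window of length `n` of `a` starting at `i` is strict and is attained at
offset `m`. Minima are encoded as peaks of `-a`. -/
def IsPeak (a : ℕ → ℝ) (i n m : ℕ) : Prop :=
  m < n ∧ ∀ p < n, p ≠ m → a (i + p) < a (i + m)

/-- There is no increasing sequence of indices with bounded gaps along which `a` is strictly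
monotone. -/
def NoMonotoneChain (a : ℕ → ℝ) : Prop :=
  ∀ (L : ℕ) (j : ℕ → ℕ), (∀ k, j k < j (k + 1)) → (∀ k, j (k + 1) ≤ j k + L) →
    (¬∀ k, a (j k) < a (j (k + 1))) ∧ ¬∀ k, a (j (k + 1)) < a (j k)

theorem NoMonotoneChain.neg {a : ℕ → ℝ} (h : NoMonotoneChain a) : NoMonotoneChain (-a) := by
  intro L j h1 h2
  obtain ⟨h3, h4⟩ := h L j h1 h2
  simp only [Pi.neg_apply, neg_lt_neg_iff]
  exact ⟨h4, h3⟩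

theorem NoMonotoneChain.false_of_descent {a : ℕ → ℝ} (h : NoMonotoneChain a) (L k : ℕ)
    (G : ℕ → Prop) (hG : ∃ i, G i)
    (hs : ∀ i, G i → ∃ i', i < i' ∧ i' ≤ i + L ∧ G i' ∧ a (i' + k) < a (i + k)) : False := by
  obtain ⟨i₀, h₀⟩ := hG
  choose! f hf1 hf2 hf3 hf4 using hs
  have hG : ∀ k, G (f^[k] i₀) := by
    intro k
    induction k with
    | zero => exact h₀
    | succ k ih => rw [Function.iterate_succ_apply']; exact hf3 _ ih
  refine (h L (fun m => f^[m] i₀ + k) ?_ ?_).2 ?_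
  · intro m
    have := hf1 _ (hG m)
    simp only [Function.iterate_succ_apply']
    omega
  · intro m
    have := hf2 _ (hG m)
    simp only [Function.iterate_succ_apply']
    omega
  · intro m
    simp only [Function.iterate_succ_apply']
    exact hf4 _ (hG m)

theorem SameOrder.symm {a : ℕ → ℝ} {n i j : ℕ} (h : SameOrder a n i j) : SameOrder a n j i :=
  fun p hp q hq => (h p hp q hq).symm

theorem SameOrder.trans {a : ℕ → ℝ} {n i j k : ℕ} (h : SameOrder a n i j)
    (h' : SameOrder a n j k) : SameOrder a n i k :=
  fun p hp q hq => (h p hp q hq).trans (h' p hp q hq)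

theorem sameOrder_neg {a : ℕ → ℝ} {n i j : ℕ} : SameOrder (-a) n i j ↔ SameOrder a n i j := by
  simp only [SameOrder, Pi.neg_apply, neg_lt_neg_iff]
  exact ⟨fun h p hp q hq => h q hq p hp, fun h p hp q hq => h q hq p hp⟩

theorem IsPeak.unique {a : ℕ → ℝ} {i n m m' : ℕ} (h : IsPeak a i n m) (h' : IsPeak a i n m') :
    m = m' := by
  by_contra hne
  exact lt_asymm (h.2 m' h'.1 (Ne.symm hne)) (h'.2 m h.1 hne)

theorem IsPeak.of_sameOrder {a : ℕ → ℝ} {i j n m : ℕ} (h : IsPeak a i n m)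
    (hs : SameOrder a n i j) : IsPeak a j n m :=
  ⟨h.1, fun p hp hpm => (hs p hp m h.1).1 (h.2 p hp hpm)⟩

theorem IsPeak.mono {a : ℕ → ℝ} {i n k m : ℕ} (h : IsPeak a i n m) (hk : k ≤ n) (hm : m < k) :
    IsPeak a i k m :=
  ⟨hm, fun p hp hpm => h.2 p (hp.trans_le hk) hpm⟩

theorem exists_isPeak {a : ℕ → ℝ} (ha : Function.Injective a) (i : ℕ) {n : ℕ} (hn : 0 < n) :
    ∃ m, IsPeak a i n m := by
  obtain ⟨m, hm, hmax⟩ := (Finset.range n).exists_max_image (fun p => a (i + p))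
    ⟨0, Finset.mem_range.2 hn⟩
  refine ⟨m, Finset.mem_range.1 hm, fun p hp hpm => ?_⟩
  refine lt_of_le_of_ne (hmax p (Finset.mem_range.2 hp)) fun he => hpm ?_
  have := ha he
  omega

theorem IsPeak.not_neg {a : ℕ → ℝ} {i n m : ℕ} (hn : 2 ≤ n) (h : IsPeak a i n m)
    (h' : IsPeak (-a) i n m) : False := by
  obtain ⟨p, hp, hpm⟩ : ∃ p, p < n ∧ p ≠ m := by
    rcases Nat.eq_zero_or_pos m with rfl | hm
    · exact ⟨1, by omega, by omega⟩
    · exact ⟨0, by omega, by omega⟩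
  have h1 := h.2 p hp hpm
  have h2 := h'.2 p hp hpm
  simp only [Pi.neg_apply] at h2
  linarith

/-- Block maxima cannot be eventually monotone, so one of them exceeds both of its neighbours. -/
theorem NoMonotoneChain.exists_local_max {a : ℕ → ℝ} (hc : NoMonotoneChain a)
    (ha : Function.Injective a) (n : ℕ) :
    ∃ i, n ≤ i ∧ ∀ j, i ≤ j + n → j ≤ i + n → j ≠ i → a j < a i := by
  set d := n + 1 with hd
  choose m hm using fun k => exists_isPeak ha (k * d) (n := d) (by omega)
  set J : ℕ → ℕ := fun k => k * d + m k with hJ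
  have hmd : ∀ k, m k < d := fun k => (hm k).1
  have hblock : ∀ k j, k * d ≤ j → j < k * d + d → j ≠ J k → a j < a (J k) := by
    intro k j h1 h2 h3
    have hJk : J k = k * d + m k := rfl
    have := (hm k).2 (j - k * d) (by omega) (by omega)
    rwa [show k * d + (j - k * d) = j by omega] at this
  have hJlt : ∀ k, J k < J (k + 1) := by
    intro k
    have := hmd k
    simp only [hJ, Nat.add_mul]
    omega
  have hJle : ∀ k, J (k + 1) ≤ J k + 2 * d := by
    intro k
    have := hmd (k + 1)
    simp only [hJ, Nat.add_mul]
    omega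
  by_contra hno
  push Not at hno
  have key : ∀ k, a (J k) < a (J (k + 1)) → a (J (k + 1)) < a (J (k + 2)) := by
    intro k hlt
    by_contra hge
    have hlt2 : a (J (k + 2)) < a (J (k + 1)) := by
      refine lt_of_le_of_ne (not_lt.1 hge) fun he => ?_
      exact (hJlt (k + 1)).ne' (ha he)
    have e1 : (k + 1) * d = k * d + d := by ring
    have e2 : (k + 2) * d = k * d + 2 * d := by ring
    have e3 : J (k + 1) = k * d + d + m (k + 1) := by simp only [hJ, e1]
    have hm1 := hmd (k + 1)
    obtain ⟨j, h1, h2, h3, h4⟩ := hno (J (k + 1)) (by omega)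
    refine absurd h4 (not_le.2 ?_)
    rcases lt_or_ge j (k * d + d) with hj | hj
    · rcases eq_or_ne j (J k) with rfl | hne
      · exact hlt
      · exact (hblock k j (by omega) hj hne).trans hlt
    · rcases lt_or_ge j (k * d + 2 * d) with hj' | hj'
      · exact hblock (k + 1) j (by omega) (by omega) h3
      · rcases eq_or_ne j (J (k + 2)) with rfl | hne
        · exact hlt2
        · exact (hblock (k + 2) j (by omega) (by omega) hne).trans hlt2
  by_cases hup : ∃ k, a (J k) < a (J (k + 1))
  · obtain ⟨k₀, hup⟩ := hup
    refine (hc (2 * d) (fun k => J (k₀ + k)) (fun k => hJlt _) (fun k => hJle _)).1 fun k => ?_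
    induction k with
    | zero => exact hup
    | succ k ih => exact key (k₀ + k) ih
  · push Not at hup
    exact (hc (2 * d) J hJlt hJle).2 fun k =>
      lt_of_le_of_ne (hup k) fun he => (hJlt k).ne' (ha he)

theorem NoMonotoneChain.exists_isPeak_at {a : ℕ → ℝ} (hc : NoMonotoneChain a)
    (ha : Function.Injective a) {n m : ℕ} (hm : m < n) : ∃ i, IsPeak a i n m := by
  obtain ⟨i, hi, hmax⟩ := hc.exists_local_max ha n
  refine ⟨i - m, hm, fun p hp hpm => ?_⟩
  rw [show i - m + m = i by omega]
  exact hmax _ (by omega) (by omega) (by omega)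

/-! ### Windows determined by the position of their maximum -/

/-- The order-theoretic content of minimal complexity: the relative order of a window is
determined by the position of its maximum, and also by the position of its minimum. -/
structure IsMinimal (a : ℕ → ℝ) : Prop where
  injective : Function.Injective a
  noMonotoneChain : NoMonotoneChain a
  sameOrder_of_isPeak : ∀ {n i j m : ℕ}, IsPeak a i n m → IsPeak a j n m → SameOrder a n i j
  sameOrder_of_isPeak_neg :
    ∀ {n i j m : ℕ}, IsPeak (-a) i n m → IsPeak (-a) j n m → SameOrder a n i j

namespace IsMinimal

variable {a : ℕ → ℝ} {n i j m : ℕ}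

theorem neg (h : IsMinimal a) : IsMinimal (-a) where
  injective := neg_injective.comp h.injective
  noMonotoneChain := h.noMonotoneChain.neg
  sameOrder_of_isPeak := fun h1 h2 => sameOrder_neg.2 (h.sameOrder_of_isPeak_neg h1 h2)
  sameOrder_of_isPeak_neg := fun h1 h2 => by
    rw [neg_neg] at h1 h2
    exact sameOrder_neg.2 (h.sameOrder_of_isPeak h1 h2)

theorem isPeak_last_of_not_sameOrder (h : IsMinimal a) (hn : 0 < n) (hs : SameOrder a n i j)
    (hns : ¬SameOrder a (n + 1) i j) : IsPeak a i (n + 1) n ∨ IsPeak a j (n + 1) n := by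
  obtain ⟨m, hm⟩ := exists_isPeak h.injective i (Nat.succ_pos n)
  obtain ⟨m', hm'⟩ := exists_isPeak h.injective j (Nat.succ_pos n)
  rcases (Nat.lt_succ_iff.1 hm.1).eq_or_lt with rfl | h1
  · exact Or.inl hm
  rcases (Nat.lt_succ_iff.1 hm'.1).eq_or_lt with rfl | h2
  · exact Or.inr hm'
  have h3 := ((hm.mono (Nat.le_succ n) h1).of_sameOrder hs).unique (hm'.mono (Nat.le_succ n) h2)
  subst h3
  exact absurd (h.sameOrder_of_isPeak hm hm') hns

/-- A window with two different extensions is extended by a new maximum and by a new minimum. -/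
theorem right_special (h : IsMinimal a) (hn : 0 < n) (hs : SameOrder a n i j)
    (hns : ¬SameOrder a (n + 1) i j) :
    (IsPeak a i (n + 1) n ∧ IsPeak (-a) j (n + 1) n) ∨
      (IsPeak (-a) i (n + 1) n ∧ IsPeak a j (n + 1) n) := by
  have h1 := h.isPeak_last_of_not_sameOrder hn hs hns
  have h2 := h.neg.isPeak_last_of_not_sameOrder hn (sameOrder_neg.2 hs)
    (fun h' => hns (sameOrder_neg.1 h'))
  rcases h1 with h1 | h1 <;> rcases h2 with h2 | h2
  · exact (h1.not_neg (by omega) h2).elim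
  · exact Or.inl ⟨h1, h2⟩
  · exact Or.inr ⟨h2, h1⟩
  · exact (h1.not_neg (by omega) h2).elim

/-- All windows which are extended by a new maximum or a new minimum have the same order. -/
theorem sameOrder_of_isPeak_last (h : IsMinimal a) (hn : 0 < n) (hi : IsPeak a i (n + 1) n)
    (hj : IsPeak (-a) j (n + 1) n) : SameOrder a n i j := by
  obtain ⟨f, hf⟩ := exists_isPeak h.injective i hn
  obtain ⟨k, hk⟩ := h.noMonotoneChain.exists_isPeak_at h.injective (hf.1.trans (Nat.lt_succ_self n))
  have hik : SameOrder a n i k := h.sameOrder_of_isPeak hf (hk.mono (Nat.le_succ n) hf.1)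
  have hns : ¬SameOrder a (n + 1) i k := fun hs =>
    absurd ((hi.of_sameOrder hs).unique hk) (by have := hf.1; omega)
  rcases h.right_special hn hik hns with ⟨-, h2⟩ | ⟨h1, -⟩
  · have := h.sameOrder_of_isPeak_neg h2 hj
    exact hik.trans fun p hp q hq => this p (by omega) q (by omega)
  · exact (hi.not_neg (by omega) h1).elim

end IsMinimal

/-! ### Circular orders -/

/-- The strict circular order induced on the line: going up from `x` and wrapping around, one
meets `y` strictly before `z`. -/
def Cyc (x y z : ℝ) : Prop := (x < y ∧ y < z) ∨ (y < z ∧ z < x) ∨ (z < x ∧ x < y)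

theorem Cyc.rotate {x y z : ℝ} (h : Cyc x y z) : Cyc y z x := by
  unfold Cyc at *; tauto

theorem Cyc.neg {x y z : ℝ} (h : Cyc x y z) : Cyc (-y) (-x) (-z) := by
  unfold Cyc at *; simp only [neg_lt_neg_iff]; tauto

theorem Cyc.not_swap {x y z : ℝ} (h : Cyc x y z) : ¬Cyc y x z := by
  rintro (h' | h' | h') <;> rcases h with h | h | h <;> linarith [h.1, h.2, h'.1, h'.2]

theorem cyc_or_swap {x y z : ℝ} (h1 : x ≠ y) (h2 : y ≠ z) (h3 : z ≠ x) :
    Cyc x y z ∨ Cyc y x z := by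
  unfold Cyc
  rcases h1.lt_or_gt with h1 | h1 <;> rcases h2.lt_or_gt with h2 | h2 <;>
    rcases h3.lt_or_gt with h3 | h3 <;> tauto

theorem Cyc.ne {x y z : ℝ} (h : Cyc x y z) : x ≠ y ∧ y ≠ z ∧ z ≠ x := by
  rcases h with h | h | h <;> refine ⟨?_, ?_, ?_⟩ <;> intro he <;> linarith [h.1, h.2]

theorem Cyc.separate {x y s t : ℝ} (h : Cyc x y t) (h' : Cyc y x s) : Cyc x s t ∧ Cyc s y t := by
  unfold Cyc at *
  rcases h with h | h | h <;> rcases h' with h' | h' | h' <;> constructor <;>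
    first
    | exact Or.inl ⟨by linarith [h.1, h.2, h'.1, h'.2], by linarith [h.1, h.2, h'.1, h'.2]⟩
    | exact Or.inr (Or.inl ⟨by linarith [h.1, h.2, h'.1, h'.2], by linarith [h.1, h.2, h'.1, h'.2]⟩)
    | exact Or.inr (Or.inr ⟨by linarith [h.1, h.2, h'.1, h'.2], by linarith [h.1, h.2, h'.1, h'.2]⟩)

theorem Cyc.false_of_separate {x y s t : ℝ} (h : Cyc y x t) (h1 : Cyc x s t) (h2 : Cyc s y t) :
    False := by
  rcases h with h | h | h <;> rcases h1 with h1 | h1 | h1 <;> rcases h2 with h2 | h2 | h2 <;>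
    linarith [h.1, h.2, h1.1, h1.2, h2.1, h2.2]

/-- All windows of length `n` of `a` are in the same relative circular order. -/
def CycInvariant (a : ℕ → ℝ) (n : ℕ) : Prop :=
  ∀ i j, ∀ p < n, ∀ q < n, ∀ r < n,
    Cyc (a (i + p)) (a (i + q)) (a (i + r)) → Cyc (a (j + p)) (a (j + q)) (a (j + r))

theorem CycInvariant.neg {a : ℕ → ℝ} {n : ℕ} (h : CycInvariant a n) : CycInvariant (-a) n := by
  intro i j p hp q hq r hr hc
  have h1 := hc.neg
  simp only [Pi.neg_apply, neg_neg] at h1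
  exact (h i j q hq p hp r hr h1).neg

/-- If two windows of length `n + 1` order the offsets `0`, `n` and some `t` differently, then
`0` and `n` are circularly adjacent in these windows. -/
theorem CycInvariant.adjacent {a : ℕ → ℝ} {n i j t : ℕ} (h : CycInvariant a n)
    (ha : Function.Injective a) (ht : 0 < t) (htn : t < n)
    (hi : Cyc (a i) (a (i + n)) (a (i + t))) (hj : Cyc (a (j + n)) (a j) (a (j + t))) :
    (∀ s, 0 < s → s < n → Cyc (a i) (a (i + n)) (a (i + s))) ∧
      ∀ s, 0 < s → s < n → Cyc (a (j + n)) (a j) (a (j + s)) := by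
  have hlow : ∀ i j s, 0 < s → s < n → Cyc (a i) (a (i + s)) (a (i + t)) →
      Cyc (a j) (a (j + s)) (a (j + t)) := fun i j s _ hs hc =>
    h i j 0 (by omega) s hs t htn hc
  have hhigh : ∀ i j s, 0 < s → s < n → Cyc (a (i + s)) (a (i + n)) (a (i + t)) →
      Cyc (a (j + s)) (a (j + n)) (a (j + t)) := by
    intro i j s hs hsn hc
    have := h (i + 1) (j + 1) (s - 1) (by omega) (n - 1) (by omega) (t - 1) (by omega)
    rw [show i + 1 + (s - 1) = i + s by omega, show i + 1 + (n - 1) = i + n by omega,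
      show i + 1 + (t - 1) = i + t by omega, show j + 1 + (s - 1) = j + s by omega,
      show j + 1 + (n - 1) = j + n by omega, show j + 1 + (t - 1) = j + t by omega] at this
    exact this hc
  have hne : ∀ k s, 0 < s → s < n → Cyc (a k) (a (k + n)) (a (k + s)) ∨
      Cyc (a (k + n)) (a k) (a (k + s)) := fun k s hs hsn =>
    cyc_or_swap (ha.ne (by omega)) (ha.ne (by omega)) (ha.ne (by omega))
  constructor
  · intro s hs hsn
    refine (hne i s hs hsn).resolve_right fun hc => ?_
    obtain ⟨h1, h2⟩ := hi.separate hc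
    exact hj.false_of_separate (hlow i j s hs hsn h1) (hhigh i j s hs hsn h2)
  · intro s hs hsn
    refine (hne j s hs hsn).resolve_left fun hc => ?_
    obtain ⟨h1, h2⟩ := hj.separate hc
    have hst : s ≠ t := by rintro rfl; exact h1.ne.2.1 rfl
    -- The statements transferred between windows are the reversed circular orders.
    refine hi.false_of_separate (s := a (i + s)) ?_ ?_
    · refine (cyc_or_swap (ha.ne (by omega)) (ha.ne (by omega)) (ha.ne (by omega))).resolve_right
        fun hc' => ?_
      exact h1.not_swap (hhigh i j s hs hsn hc')
    · refine (cyc_or_swap (ha.ne (by omega)) (ha.ne (by omega)) (ha.ne (by omega))).resolve_right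
        fun hc' => ?_
      exact h2.not_swap (hlow i j s hs hsn hc')

/-! ### Invariance of the circular order under the shift -/

namespace IsMinimal

variable {a : ℕ → ℝ} {n : ℕ}

/-- If only windows with their maximum in front can be extended by a new maximum, then a maximum
remains the maximum of the moving window until it reaches the front. -/
theorem isPeak_shift (hext : ∀ i m, IsPeak a i n m → m ≠ 0 → IsPeak a i (n + 1) m) :
    ∀ (k m i : ℕ), IsPeak a i n (m + k) → IsPeak a (i + k) n m := by
  intro k
  induction k with
  | zero => intro m i h; exact h
  | succ k ih =>
    intro m i h
    have h1 := hext _ _ h (by omega)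
    have h2 : IsPeak a (i + 1) n (m + k) := by
      refine ⟨by have := h.1; omega, fun p hp hpm => ?_⟩
      have := h1.2 (p + 1) (by omega) (by omega)
      rwa [show i + (p + 1) = i + 1 + p by omega,
        show i + (m + (k + 1)) = i + 1 + (m + k) by omega] at this
    have h3 := ih m (i + 1) h2
    rwa [show i + 1 + k = i + (k + 1) by omega] at h3

/-- In windows extended by a new maximum let the offset `0` hold the second maximum. Then there is
no window of length `n + 1` in which the last element comes circularly just before the first one.
The return times are the indices `j` at which `a j` is the maximum of the next `n` elements;
consecutive ones differ by `n` or by the position `f` of the second maximum. If `m` is the position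
of the maximum in a forbidden window, then `a` decreases along all the return times shifted by `-m`
if `m < f`, and along those shifted by `n - m` if `f < m`. -/
theorem false_of_adjacent (h : IsMinimal a) (hn : 2 ≤ n) (hC : CycInvariant a n)
    (hA : ∀ i, IsPeak a i (n + 1) n → ∀ s, 0 < s → s < n → a (i + s) < a i)
    (hB : ∃ i, ∀ s, 0 < s → s < n → Cyc (a (i + n)) (a i) (a (i + s))) : False := by
  have hA0 : ∀ i, IsPeak a i (n + 1) n → IsPeak a i n 0 := fun i hi =>
    ⟨by omega, fun p hp hp0 => hA i hi p (by omega) hp⟩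
  obtain ⟨i₀, hi₀⟩ := h.noMonotoneChain.exists_isPeak_at h.injective (Nat.lt_succ_self n)
  have hA1 : ∀ i, IsPeak (-a) i (n + 1) n → IsPeak a i n 0 := fun i hi =>
    (hA0 i₀ hi₀).of_sameOrder (h.sameOrder_of_isPeak_last (by omega) hi₀ hi)
  have hret : ∀ j, IsPeak a j n 0 → IsPeak a j (n + 1) n ∨ IsPeak (-a) j (n + 1) n := by
    intro j hj
    by_cases hs : SameOrder a (n + 1) i₀ j
    · exact Or.inl (hi₀.of_sameOrder hs)
    · rcases h.right_special (by omega) (h.sameOrder_of_isPeak (hA0 _ hi₀) hj) hs with h1 | h1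
      · exact Or.inr h1.2
      · exact Or.inl h1.2
  have hext : ∀ i m, IsPeak a i n m → m ≠ 0 → IsPeak a i (n + 1) m := by
    intro i m hm hm0
    obtain ⟨m', hm'⟩ := exists_isPeak h.injective i (Nat.succ_pos n)
    rcases (Nat.lt_succ_iff.1 hm'.1).eq_or_lt with rfl | h1
    · exact absurd (hm.unique (hA0 i hm')) hm0
    · rwa [hm.unique (hm'.mono (Nat.le_succ n) h1)]
  have hshift := isPeak_shift hext
  obtain ⟨f, hf0, hfn, hf⟩ : ∃ f, 0 < f ∧ f < n ∧
      ∀ s, 0 < s → s < n → s ≠ f → a (i₀ + s) < a (i₀ + f) := by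
    obtain ⟨f, hf⟩ := exists_isPeak h.injective (i₀ + 1) (n := n - 1) (by omega)
    have := hf.1
    refine ⟨f + 1, by omega, by omega, fun s hs hsn hsf => ?_⟩
    have := hf.2 (s - 1) (by omega) (by omega)
    rwa [show i₀ + 1 + (s - 1) = i₀ + s by omega, show i₀ + 1 + f = i₀ + (f + 1) by omega] at this
  have hfret : ∀ j, IsPeak a j n 0 → ∀ s, 0 < s → s < n → s ≠ f → a (j + s) < a (j + f) :=
    fun j hj s hs hsn hsf =>
      (h.sameOrder_of_isPeak (hA0 _ hi₀) hj s hsn f hfn).1 (hf s hs hsn hsf)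
  have hfcyc : ∀ i s, 0 < s → s < n → s ≠ f → Cyc (a i) (a (i + s)) (a (i + f)) :=
    fun i s hs hsn hsf => hC i₀ i 0 (by omega) s hsn f hfn
      (Or.inr (Or.inl ⟨hf s hs hsn hsf, hA i₀ hi₀ f hf0 hfn⟩))
  have hmax : ∀ j, IsPeak a j (n + 1) n → IsPeak a (j + 1) n (n - 1) := by
    intro j hj
    refine ⟨by omega, fun p hp hpn => ?_⟩
    have := hj.2 (p + 1) (by omega) (by omega)
    rwa [show j + (p + 1) = j + 1 + p by omega, show j + n = j + 1 + (n - 1) by omega] at this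
  have hmin : ∀ j, IsPeak (-a) j (n + 1) n → IsPeak a (j + 1) n (f - 1) := by
    intro j hj
    refine ⟨by omega, fun p hp hpn => ?_⟩
    rw [show j + 1 + p = j + (p + 1) by omega, show j + 1 + (f - 1) = j + f by omega]
    rcases eq_or_ne (p + 1) n with he | hne
    · have := hj.2 f (by omega) (by omega)
      simp only [Pi.neg_apply, neg_lt_neg_iff] at this
      rwa [he]
    · exact hfret j (hA1 j hj) (p + 1) (by omega) (by omega) (by omega)
  obtain ⟨i₁, hi₁⟩ := hB
  obtain ⟨m, hm⟩ := exists_isPeak h.injective i₁ (Nat.succ_pos n)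
  have hmn : m ≠ n := by
    rintro rfl
    have h1 := hA i₁ hm 1 (by omega) (by omega)
    have h2 := hm.2 0 (by omega) (by omega)
    rw [add_zero] at h2
    rcases hi₁ 1 (by omega) (by omega) with h3 | h3 | h3 <;> linarith [h3.1, h3.2]
  have hm0 : m ≠ 0 := by
    rintro rfl
    have h0 := hm.mono (Nat.le_succ n) (by omega)
    rcases hret i₁ h0 with h1 | h1
    · exact hmn (hm.unique h1)
    · have h2 := h0.2 1 (by omega) (by omega)
      have h3 := h1.2 1 (by omega) (by omega)
      simp only [Pi.neg_apply, neg_lt_neg_iff, add_zero] at h2 h3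
      rcases hi₁ 1 (by omega) (by omega) with h4 | h4 | h4 <;> linarith [h4.1, h4.2]
  have hmlt : m < n := by have := hm.1; omega
  have hdesc : ∀ i, IsPeak a i n m → a (i + n) < a i := by
    intro i hi
    have hs := h.sameOrder_of_isPeak hm (hext i m hi hm0)
    have h1 := hm.2 n (by omega) (by omega)
    have h2 := hm.2 0 (by omega) (by omega)
    rw [add_zero] at h2
    refine (hs n (by omega) 0 (by omega)).1 ?_
    rw [add_zero]
    rcases hi₁ m (by omega) hmlt with h4 | h4 | h4 <;> linarith [h4.1, h4.2]
  have hmf : m ≠ f := by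
    rintro rfl
    have h1 := hdesc i₁ (hm.mono (Nat.le_succ n) hmlt)
    refine hm0 ((hm.mono (Nat.le_succ n) hmlt).unique (hA1 i₁ ⟨by omega, fun p hp hpn => ?_⟩))
    simp only [Pi.neg_apply, neg_lt_neg_iff]
    refine h1.trans_le ?_
    rcases eq_or_ne p 0 with rfl | hp0
    · simp
    rcases eq_or_ne p m with rfl | hpm
    · have := hm.2 0 (by omega) (by omega)
      rw [add_zero] at this
      exact this.le
    have h2 := hm.2 p (by omega) hpm
    have h3 := hm.2 0 (by omega) (by omega)
    rw [add_zero] at h3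
    rcases hfcyc i₁ p (by omega) (by omega) hpm with h4 | h4 | h4 <;> linarith [h4.1, h4.2]
  rcases hmf.lt_or_gt with hlt | hgt
  · refine h.noMonotoneChain.false_of_descent n 0 (fun i => IsPeak a i n m)
      ⟨i₁, hm.mono (Nat.le_succ n) hmlt⟩ fun i hi => ?_
    have hj : IsPeak a (i + m) n 0 := hshift m 0 i (by rwa [Nat.zero_add])
    rcases hret _ hj with h1 | h1
    · refine ⟨i + n, by omega, le_rfl, ?_, hdesc i hi⟩
      have h2 := hshift (n - 1 - m) m _
        (by rw [show m + (n - 1 - m) = n - 1 by omega]; exact hmax _ h1)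
      rwa [show i + m + 1 + (n - 1 - m) = i + n by omega] at h2
    · refine ⟨i + f, by omega, by omega, ?_, ?_⟩
      · have h2 := hshift (f - 1 - m) m _
          (by rw [show m + (f - 1 - m) = f - 1 by omega]; exact hmin _ h1)
        rwa [show i + m + 1 + (f - 1 - m) = i + f by omega] at h2
      · have h2 := hi.2 f hfn (by omega)
        have h3 := hi.2 0 (by omega) (by omega)
        simp only [add_zero] at h3 ⊢
        rcases hfcyc i m (by omega) hmlt hmf with h4 | h4 | h4 <;> linarith [h4.1, h4.2]
  · refine h.noMonotoneChain.false_of_descent n (n - m) (fun j => IsPeak a j n 0)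
      ⟨i₀, hA0 i₀ hi₀⟩ fun j hj => ?_
    rcases hret _ hj with h1 | h1
    · refine ⟨j + n, by omega, le_rfl, ?_, ?_⟩
      · have h2 := hshift (n - 1) 0 _ (by rw [Nat.zero_add]; exact hmax _ h1)
        rwa [show j + 1 + (n - 1) = j + n by omega] at h2
      · have h2 := hshift (n - 1 - m) m _
          (by rw [show m + (n - 1 - m) = n - 1 by omega]; exact hmax _ h1)
        have h3 := hdesc _ h2
        rwa [show j + 1 + (n - 1 - m) + n = j + n + (n - m) by omega,
          show j + 1 + (n - 1 - m) = j + (n - m) by omega] at h3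
    · refine ⟨j + f, by omega, by omega, ?_, ?_⟩
      · have h2 := hshift (f - 1) 0 _ (by rw [Nat.zero_add]; exact hmin _ h1)
        rwa [show j + 1 + (f - 1) = j + f by omega] at h2
      · have h2 := h1.2 (n - m) (by omega) (by omega)
        simp only [Pi.neg_apply, neg_lt_neg_iff] at h2
        have h4 := hfcyc (j + (n - m)) m (by omega) hmlt hmf
        rw [show j + (n - m) + m = j + n by omega,
          show j + (n - m) + f = j + f + (n - m) by omega] at h4
        rcases h4 with h4 | h4 | h4 <;> linarith [h4.1, h4.2]

theorem cycInvariant_succ (h : IsMinimal a) (hn : 2 ≤ n) (hC : CycInvariant a n) :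
    CycInvariant a (n + 1) := by
  have hne : ∀ {x y}, x ≠ y → a x ≠ a y := fun hxy => h.injective.ne hxy
  obtain ⟨i₀, hi₀⟩ := h.noMonotoneChain.exists_isPeak_at h.injective (Nat.lt_succ_self n)
  -- Circular orders can only differ on the first offset, the last one and a third one.
  have key : ∀ i j t, 0 < t → t < n → Cyc (a i) (a (i + n)) (a (i + t)) →
      Cyc (a (j + n)) (a j) (a (j + t)) → False := by
    intro i j t ht htn hi hj
    rcases cyc_or_swap (hne (show i₀ ≠ i₀ + n by omega)) (hne (show i₀ + n ≠ i₀ + t by omega))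
      (hne (show i₀ + t ≠ i₀ by omega)) with h0 | h0
    · refine h.false_of_adjacent hn hC (fun i' hi' s hs hsn => ?_)
        ⟨j, (hC.adjacent h.injective ht htn hi hj).2⟩
      have h1 := (hC.adjacent h.injective ht htn h0 hj).1 s hs hsn
      have h2 := hi₀.2 0 (by omega) (by omega)
      have h3 := hi₀.2 s (by omega) (by omega)
      have h4 := h.sameOrder_of_isPeak hi₀ hi' s (by omega) 0 (by omega)
      rw [add_zero] at h2
      simp only [add_zero] at h4
      refine h4.1 ?_
      rcases h1 with h1 | h1 | h1 <;> linarith [h1.1, h1.2]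
    · refine h.neg.false_of_adjacent hn hC.neg (fun i' hi' s hs hsn => ?_)
        ⟨i, fun s hs hsn => ((hC.adjacent h.injective ht htn hi hj).1 s hs hsn).neg⟩
      have h1 := (hC.adjacent h.injective ht htn hi h0).2 s hs hsn
      have h2 := hi₀.2 0 (by omega) (by omega)
      have h3 := hi₀.2 s (by omega) (by omega)
      have h4 := h.sameOrder_of_isPeak_last (by omega) hi₀ hi' 0 (by omega) s hsn
      rw [add_zero] at h2
      simp only [add_zero] at h4
      simp only [Pi.neg_apply, neg_lt_neg_iff]
      refine h4.1 ?_
      rcases h1 with h1 | h1 | h1 <;> linarith [h1.1, h1.2]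
  -- The offset `0` is in the last place here; the other places follow by rotation.
  have key' : ∀ i j p q, p ≤ n → q ≤ n → 0 < p → p ≠ q →
      Cyc (a (i + p)) (a (i + q)) (a i) → Cyc (a (j + p)) (a (j + q)) (a j) := by
    intro i j p q hp hq hp0 hpq hc
    have hq0 : q ≠ 0 := by rintro rfl; exact hc.ne.2.1 rfl
    rcases hp.eq_or_lt with rfl | hpn
    · by_contra hcj
      have hcj' := (cyc_or_swap (hne (by omega)) (hne (by omega)) (hne (by omega))).resolve_left hcj
      exact key i j q (by omega) (by omega) hc.rotate.rotate hcj'.rotate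
    rcases hq.eq_or_lt with rfl | hqn
    · by_contra hcj
      have hcj' := (cyc_or_swap (hne (by omega)) (hne (by omega)) (hne (by omega))).resolve_left hcj
      exact key j i p hp0 hpn hcj'.rotate.rotate hc.rotate
    exact hC i j p hpn q hqn 0 (by omega) hc
  have key2 : ∀ i j p q r, p ≤ n → q ≤ n → r ≤ n →
      Cyc (a (i + p)) (a (i + q)) (a (i + r)) → 0 < p → 0 < q → 0 < r →
        Cyc (a (j + p)) (a (j + q)) (a (j + r)) := by
    intro i j p q r hp hq hr hc hp0 hq0 hr0
    have := hC (i + 1) (j + 1) (p - 1) (by omega) (q - 1) (by omega) (r - 1) (by omega)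
    simp only [show ∀ i, i + 1 + (p - 1) = i + p by omega, show ∀ i, i + 1 + (q - 1) = i + q by omega,
      show ∀ i, i + 1 + (r - 1) = i + r by omega] at this
    exact this hc
  intro i j p hp q hq r hr hc
  rw [Nat.lt_succ_iff] at hp hq hr
  have hd := hc.ne
  have hpq : p ≠ q := fun he => hd.1 (by rw [he])
  have hqr : q ≠ r := fun he => hd.2.1 (by rw [he])
  have hrp : r ≠ p := fun he => hd.2.2 (by rw [he])
  rcases Nat.eq_zero_or_pos r with rfl | hr0
  · exact key' i j p q hp hq (by omega) hpq hc
  rcases Nat.eq_zero_or_pos q with rfl | hq0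
  · exact (key' i j r p hr hp (by omega) hrp hc.rotate.rotate).rotate
  rcases Nat.eq_zero_or_pos p with rfl | hp0
  · exact (key' i j q r hq hr (by omega) hqr hc.rotate).rotate.rotate
  exact key2 i j p q r hp hq hr hc hp0 hq0 hr0

theorem cycInvariant (h : IsMinimal a) (n : ℕ) : CycInvariant a n := by
  have hsucc : ∀ k, CycInvariant a (k + 2) := by
    intro k
    induction k with
    | zero =>
      intro i j p hp q hq r hr hc
      have hd := hc.ne
      have hpq : p ≠ q := fun he => hd.1 (by rw [he])
      have hqr : q ≠ r := fun he => hd.2.1 (by rw [he])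
      have hrp : r ≠ p := fun he => hd.2.2 (by rw [he])
      omega
    | succ k ih => exact h.cycInvariant_succ (by omega) ih
  exact fun i j p hp q hq r hr => hsucc n i j p (by omega) q (by omega) r (by omega)

/-- The shift preserves the circular order. -/
theorem cyc_shift_iff (h : IsMinimal a) (i j k : ℕ) :
    Cyc (a i) (a j) (a k) ↔ Cyc (a (i + 1)) (a (j + 1)) (a (k + 1)) := by
  have hC := h.cycInvariant (i + j + k + 1)
  have h1 := hC 0 1 i (by omega) j (by omega) k (by omega)
  have h2 := hC 1 0 i (by omega) j (by omega) k (by omega)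
  simp only [zero_add, add_comm 1] at h1 h2
  exact ⟨h1, h2⟩

end IsMinimal

/-! ### Factors and complexity -/

namespace InfinitePermutation

theorem factor_mk_eq_iff {a : ℕ → ℝ} (ha : Function.Injective a) (n i j : ℕ) :
    factor (OrderPattern.mk a ha) i n = factor (OrderPattern.mk a ha) j n ↔
      SameOrder a n i j := by
  have hinj : ∀ i : ℕ, Function.Injective fun k : Fin n => a (i + (k : ℕ)) := fun i k l h =>
    Fin.ext (Nat.add_left_cancel (ha h))
  have h : ∀ i, factor (OrderPattern.mk a ha) i n =
      OrderPattern.mk (fun k : Fin n => a (i + (k : ℕ))) (hinj i) := fun i => rfl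
  rw [h, h, OrderPattern.mk_eq_mk]
  exact ⟨fun h p hp q hq => h ⟨p, hp⟩ ⟨q, hq⟩, fun h p q => h p p.2 q q.2⟩

section

variable {a : ℕ → ℝ} (ha : Function.Injective a)

/-- Windows with their maxima at distinct positions give distinct factors. The sequence `b` is `a`
or `-a`. -/
theorem injective_factor_of_isPeak {b : ℕ → ℝ} (hs : ∀ n i j, SameOrder b n i j ↔ SameOrder a n i j)
    {n : ℕ} {I : Fin n → ℕ} (hI : ∀ m, IsPeak b (I m) n m) :
    Function.Injective fun m => factor (OrderPattern.mk a ha) (I m) n := by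
  intro m m' h
  exact Fin.ext (((hI m).of_sameOrder ((hs _ _ _).2
    ((factor_mk_eq_iff ha n _ _).1 h))).unique (hI m'))

theorem le_complexity_mk (hc : NoMonotoneChain a) (n : ℕ) :
    n ≤ complexity (OrderPattern.mk a ha) n := by
  choose I hI using fun m : Fin n => hc.exists_isPeak_at ha m.2
  have h := Nat.card_range_of_injective
    (injective_factor_of_isPeak ha (fun _ _ _ => Iff.rfl) hI)
  rw [Nat.card_fin, Nat.card_coe_set_eq] at h
  exact h.ge.trans (Set.ncard_le_ncard (by rintro _ ⟨m, rfl⟩; exact ⟨I m, rfl⟩) (Set.toFinite _))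

/-- If there are only `n` factors of length `n`, each of them has its own position of the
maximum. -/
theorem sameOrder_of_complexity_eq {b : ℕ → ℝ} (hb : Function.Injective b)
    (hs : ∀ n i j, SameOrder b n i j ↔ SameOrder a n i j) (hc : NoMonotoneChain b)
    {n : ℕ} (hn : complexity (OrderPattern.mk a ha) n = n) {i j m : ℕ} (hi : IsPeak b i n m)
    (hj : IsPeak b j n m) : SameOrder a n i j := by
  choose I hI using fun m : Fin n => hc.exists_isPeak_at hb m.2
  have hcard := Nat.card_range_of_injective (injective_factor_of_isPeak ha hs hI)
  rw [Nat.card_fin, Nat.card_coe_set_eq] at hcard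
  have heq : (Set.range fun m => factor (OrderPattern.mk a ha) (I m) n) =
      Set.range fun i => factor (OrderPattern.mk a ha) i n :=
    Set.eq_of_subset_of_ncard_le (by rintro _ ⟨m, rfl⟩; exact ⟨I m, rfl⟩)
      (hn.le.trans hcard.ge) (Set.toFinite _)
  have hrep : ∀ i, IsPeak b i n m → ∀ hm : m < n, SameOrder a n (I ⟨m, hm⟩) i := by
    intro i hi hm
    obtain ⟨m', hm'⟩ : factor (OrderPattern.mk a ha) i n ∈
        Set.range fun m => factor (OrderPattern.mk a ha) (I m) n := heq ▸ ⟨i, rfl⟩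
    have h1 := (factor_mk_eq_iff ha n _ _).1 hm'
    have h2 : m' = ⟨m, hm⟩ := Fin.ext (((hI m').of_sameOrder ((hs _ _ _).2 h1)).unique hi)
    rwa [h2] at h1
  exact (hrep i hi hi.1).symm.trans (hrep j hj hi.1)

theorem isMinimal_of_complexity_eq (hc : NoMonotoneChain a)
    (h : ∀ n, 1 ≤ n → complexity (OrderPattern.mk a ha) n = n) : IsMinimal a where
  injective := ha
  noMonotoneChain := hc
  sameOrder_of_isPeak := fun hi hj =>
    sameOrder_of_complexity_eq ha ha (fun _ _ _ => Iff.rfl) hc (h _ (by have := hi.1; omega)) hi hj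
  sameOrder_of_isPeak_neg := fun hi hj =>
    sameOrder_of_complexity_eq ha (neg_injective.comp ha) (fun _ _ _ => sameOrder_neg) hc.neg
      (h _ (by have := hi.1; omega)) hi hj

theorem complexity_mk_le {n : ℕ} (c : ℕ → ℕ) (hc : ∀ i, c i < n)
    (h : ∀ i j, c i = c j → SameOrder a n i j) : complexity (OrderPattern.mk a ha) n ≤ n := by
  have hsurj : (Set.range fun i => factor (OrderPattern.mk a ha) i n).ncard ≤
      (Set.Iio n : Set ℕ).ncard := by
    refine Set.ncard_le_ncard_of_injOn
      (fun u => c (Function.invFun (fun i => factor (OrderPattern.mk a ha) i n) u))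
      (fun u _ => hc _) ?_ (Set.toFinite _)
    rintro _ ⟨i, rfl⟩ _ ⟨j, rfl⟩ hij
    have h1 := (factor_mk_eq_iff ha n _ _).2 (h _ _ hij)
    have h2 : ∀ i, factor (OrderPattern.mk a ha) (Function.invFun
        (fun i => factor (OrderPattern.mk a ha) i n) (factor (OrderPattern.mk a ha) i n)) n =
          factor (OrderPattern.mk a ha) i n := fun i =>
      Function.invFun_eq (f := fun i => factor (OrderPattern.mk a ha) i n) ⟨i, rfl⟩
    rw [h2, h2] at h1
    exact h1
  have h3 : (Set.Iio n : Set ℕ).ncard = n := by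
    rw [← Finset.coe_range, Set.ncard_coe_finset, Finset.card_range]
  exact hsurj.trans h3.le

end

end InfinitePermutation

/-! ### Equidistributed sequences -/

namespace IsEquidistributedSeq

variable {x : ℕ → ℝ}

/-- An interval visited at bounded gaps `L` has length at least `1 / L`. -/
theorem one_le_mul_of_chain (hx : IsEquidistributedSeq 0 1 x) {s t : ℝ} (hs : s ∈ Set.Icc (0 : ℝ) 1)
    (ht : t ∈ Set.Icc (0 : ℝ) 1) {L : ℕ} {j : ℕ → ℕ} (hj : ∀ k, j k < j (k + 1))
    (hjL : ∀ k, j (k + 1) ≤ j k + L) (hst : ∀ k, s ≤ x (j k) ∧ x (j k) < t) :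
    1 ≤ L * (t - s) := by
  have hmono : StrictMono j := strictMono_nat_of_lt_succ hj
  have hjk : ∀ k, j k ≤ j 0 + k * L := by
    intro k
    induction k with
    | zero => simp
    | succ k ih =>
      have := hjL k
      rw [Nat.add_mul]
      omega
  have hL : 0 < L := by have := hj 0; have := hjL 0; omega
  by_contra! hlt
  have hL' : (0 : ℝ) < L := by exact_mod_cast hL
  obtain ⟨c, hc1, hc2⟩ := exists_between (show t - s < 1 / L by rwa [lt_div_iff₀ hL', mul_comm])
  rw [lt_div_iff₀ hL'] at hc2
  have hlim := (hx.2 t ht).sub (hx.2 s hs)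
  have hev := hlim.eventually (gt_mem_nhds (show (t - 0) / (1 - 0) - (s - 0) / (1 - 0) < c by
    simpa using hc1))
  obtain ⟨N, hN⟩ := eventually_atTop.1 hev
  obtain ⟨k, hk⟩ := exists_nat_gt ((c * (j 0 + 1)) / (1 - c * L))
  rw [div_lt_iff₀ (by linarith)] at hk
  set K := max k N with hK
  have hKk : (k : ℝ) ≤ K := by exact_mod_cast le_max_left k N
  set n := j 0 + K * L + 1 with hn
  have hNn : N ≤ n := by
    have h1 : N ≤ K := le_max_right _ _
    have h2 : K ≤ K * L := Nat.le_mul_of_pos_right K hL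
    omega
  have h1 := hN n hNn
  have hsub : ((Finset.range n).filter fun i => x i < s) ∪ (Finset.range (K + 1)).image j ⊆
      (Finset.range n).filter fun i => x i < t := by
    intro i hi
    simp only [Finset.mem_union, Finset.mem_filter, Finset.mem_range, Finset.mem_image] at hi ⊢
    rcases hi with ⟨h1, h2⟩ | ⟨k, hk, rfl⟩
    · exact ⟨h1, h2.trans ((hst 0).1.trans_lt (hst 0).2)⟩
    · refine ⟨?_, (hst k).2⟩
      have h2 := hmono.monotone (Nat.lt_succ_iff.1 hk)
      have := hjk K
      omega
  have hdisj : Disjoint ((Finset.range n).filter fun i => x i < s)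
      ((Finset.range (K + 1)).image j) := by
    rw [Finset.disjoint_left]
    intro i hi hi'
    obtain ⟨k, -, rfl⟩ := Finset.mem_image.1 hi'
    exact absurd (Finset.mem_filter.1 hi).2 (not_lt.2 (hst k).1)
  have hcard := Finset.card_le_card hsub
  rw [Finset.card_union_of_disjoint hdisj, Finset.card_image_of_injective _ hmono.injective,
    Finset.card_range] at hcard
  have hcard' : (((Finset.range n).filter fun i => x i < s).card : ℝ) + (K + 1) ≤
      ((Finset.range n).filter fun i => x i < t).card := by exact_mod_cast hcard
  have hn0 : (0 : ℝ) < n := by rw [hn]; positivity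
  rw [← sub_div, div_lt_iff₀ hn0] at h1
  have hnr : (n : ℝ) = j 0 + K * L + 1 := by rw [hn]; push_cast; ring
  rw [hnr] at h1
  nlinarith [mul_le_mul_of_nonneg_right hKk (show 0 ≤ 1 - c * L by linarith)]

/-- Along a monotone chain the values would converge, hence stay in an interval shorter than the
frequency of the chain. -/
theorem noMonotoneChain (hx : IsEquidistributedSeq 0 1 x) : NoMonotoneChain x := by
  intro L j hj hjL
  have hL : 0 < L := by have := hj 0; have := hjL 0; omega
  have hL' : (0 : ℝ) < 1 / L := by positivity
  have hfin : ∀ {s t : ℝ}, s ∈ Set.Icc (0 : ℝ) 1 → t ∈ Set.Icc (0 : ℝ) 1 → t - s < 1 / L → ∀ K,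
      ¬∀ k, s ≤ x (j (K + k)) ∧ x (j (K + k)) < t := by
    intro s t hs ht hlt K hst
    have h1 := hx.one_le_mul_of_chain hs ht (L := L) (j := fun k => j (K + k)) (fun k => hj _)
      (fun k => hjL _) hst
    rw [lt_div_iff₀ (by exact_mod_cast hL)] at hlt
    linarith
  constructor
  · intro h
    have hmono : StrictMono fun k => x (j k) := strictMono_nat_of_lt_succ h
    have hbdd : BddAbove (Set.range fun k => x (j k)) :=
      ⟨1, by rintro _ ⟨k, rfl⟩; exact (hx.1 _).2⟩
    have hlim := tendsto_atTop_ciSup hmono.monotone hbdd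
    set c := ⨆ k, x (j k) with hc
    have hlt : ∀ k, x (j k) < c := fun k => (h k).trans_le (le_ciSup hbdd (k + 1))
    obtain ⟨K, hK⟩ := (hlim.eventually (lt_mem_nhds (show c - 1 / L < c by linarith))).exists
    refine hfin (hx.1 (j K)) (t := c) ⟨(hx.1 (j 0)).1.trans (hlt 0).le,
      ciSup_le fun k => (hx.1 _).2⟩ (by linarith) K fun k => ⟨?_, hlt _⟩
    exact hmono.monotone (Nat.le_add_right K k)
  · intro h
    have hanti : StrictAnti fun k => x (j k) := strictAnti_nat_of_succ_lt h
    have hbdd : BddBelow (Set.range fun k => x (j k)) :=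
      ⟨0, by rintro _ ⟨k, rfl⟩; exact (hx.1 _).1⟩
    have hlim := tendsto_atTop_ciInf hanti.antitone hbdd
    set c := ⨅ k, x (j k) with hc
    have hle : ∀ k, c ≤ x (j k) := fun k => ciInf_le hbdd k
    obtain ⟨K, hK⟩ := (hlim.eventually (gt_mem_nhds (show c < c + 1 / L by linarith))).exists
    refine hfin (s := c) ⟨le_ciInf fun k => (hx.1 _).1, (hle 0).trans (hx.1 _).2⟩ (hx.1 (j K))
      (by linarith) (K + 1) fun k => ⟨hle _, ?_⟩
    exact hanti (show K < K + 1 + k by omega)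

open Classical in
/-- The frequency of visits to a circular interval is its length on the circle. -/
theorem tendsto_cyc (hx : IsEquidistributedSeq 0 1 x) (hinj : Function.Injective x) {i j : ℕ}
    (hij : i ≠ j) :
    Tendsto (fun n : ℕ => (∑ k ∈ Finset.range n, if Cyc (x i) (x k) (x j) then (1 : ℝ) else 0) / n)
      atTop (𝓝 (x j - x i + if x j < x i then 1 else 0)) := by
  have hind : ∀ k, (if Cyc (x i) (x k) (x j) then (1 : ℝ) else 0) =
      (if x k < x j then 1 else 0) - (if x k < x i then 1 else 0) - (if k = i then 1 else 0) +
        (if x j < x i then 1 else 0) := by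
    intro k
    have hne : x i ≠ x j := hinj.ne hij
    rcases eq_or_ne k i with rfl | hki
    · have : ¬Cyc (x k) (x k) (x j) := fun h => h.ne.1 rfl
      rcases hne.lt_or_gt with h | h <;> simp [this, h, h.not_gt]
    rcases eq_or_ne k j with rfl | hkj
    · have : ¬Cyc (x i) (x k) (x k) := fun h => h.ne.2.1 rfl
      rcases hne.lt_or_gt with h | h <;> simp [this, h, h.not_gt, hki]
    have h1 : x k ≠ x i := hinj.ne hki
    have h2 : x k ≠ x j := hinj.ne hkj
    rcases hne.lt_or_gt with h | h <;> rcases h1.lt_or_gt with h1 | h1 <;>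
      rcases h2.lt_or_gt with h2 | h2 <;>
      first
      | exact absurd h (by linarith)
      | simp [Cyc, h, h.not_gt, h1, h1.not_gt, h2, h2.not_gt, hki]
  have h1 := (hx.2 (x j) (hx.1 j)).sub (hx.2 (x i) (hx.1 i))
  have h2 : Tendsto (fun n : ℕ => (∑ k ∈ Finset.range n, if k = i then (1 : ℝ) else 0) / n) atTop
      (𝓝 0) := by
    refine squeeze_zero (fun n => by positivity) (fun n => ?_) tendsto_one_div_atTop_nhds_zero_nat
    refine div_le_div_of_nonneg_right ?_ (Nat.cast_nonneg n)
    rw [Finset.sum_ite_eq']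
    split_ifs <;> norm_num
  have h3 := (h1.sub h2).add_const (if x j < x i then (1 : ℝ) else 0)
  simp only [sub_zero, div_one] at h3
  refine h3.congr' ?_
  filter_upwards [eventually_gt_atTop 0] with n hn
  have hn' : (n : ℝ) ≠ 0 := by positivity
  simp only [hind, Finset.sum_add_distrib, Finset.sum_sub_distrib, Finset.sum_const,
    Finset.card_range, nsmul_eq_mul, Finset.sum_boole]
  field_simp

/-- If the shift preserves the circular order, it preserves lengths on the circle. -/
theorem exists_sub_eq_of_isMinimal (hx : IsEquidistributedSeq 0 1 x) (h : IsMinimal x) (i j : ℕ) :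
    ∃ z : ℤ, x (j + 1) - x (i + 1) = x j - x i + z := by
  classical
  rcases eq_or_ne i j with rfl | hij
  · exact ⟨0, by simp⟩
  have h1 := hx.tendsto_cyc h.injective hij
  have h2 := (hx.tendsto_cyc h.injective (show i + 1 ≠ j + 1 by omega)).comp (tendsto_add_atTop_nat 1)
  set e : ℝ := if Cyc (x (i + 1)) (x 0) (x (j + 1)) then (1 : ℝ) else 0
  have h3 : Tendsto (fun n : ℕ => (n : ℝ) / ((n + 1 : ℕ) : ℝ)) atTop (𝓝 1) := by
    simpa using tendsto_natCast_div_add_atTop (1 : ℝ)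
  have h4 : Tendsto (fun n : ℕ => e / ((n + 1 : ℕ) : ℝ)) atTop (𝓝 0) :=
    (tendsto_const_div_atTop_nhds_zero_nat e).comp (tendsto_add_atTop_nat 1)
  have h5 := (h1.mul h3).add h4
  have h6 := tendsto_nhds_unique (h2.congr' ?_) h5
  · rw [mul_one, add_zero] at h6
    refine ⟨(if x j < x i then 1 else 0) - (if x (j + 1) < x (i + 1) then 1 else 0), ?_⟩
    push_cast
    linarith
  · filter_upwards [eventually_gt_atTop 0] with n hn
    have hn' : (n : ℝ) ≠ 0 := by positivity
    simp only [Function.comp_apply, Finset.sum_range_succ', ← h.cyc_shift_iff]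
    field_simp
    rfl

theorem exists_eq_rotation (hx : IsEquidistributedSeq 0 1 x) (h : IsMinimal x) (i : ℕ) :
    ∃ z : ℤ, x i = x 0 + i * (x 1 - x 0) + z := by
  induction i with
  | zero => exact ⟨0, by simp⟩
  | succ i ih =>
    obtain ⟨z, hz⟩ := ih
    obtain ⟨w, hw⟩ := hx.exists_sub_eq_of_isMinimal h 0 i
    refine ⟨z + w, ?_⟩
    push_cast
    linarith

end IsEquidistributedSeq

namespace InfinitePermutation

theorem isSturmian_mk {x : ℕ → ℝ} (hinj : Function.Injective x) (hx : ∀ i, x i ∈ Set.Icc (0 : ℝ) 1)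
    {ρ σ : ℝ} (h : ∀ i : ℕ, ∃ z : ℤ, x i = ρ + i * σ + z) :
    IsSturmian (OrderPattern.mk x hinj) := by
  -- Two distinct values which differ by an integer are the two ends of the unit interval.
  have hends : ∀ i j, i ≠ j → (∃ z : ℤ, x i = x j + z) →
      (x i = 0 ∧ x j = 1) ∨ (x i = 1 ∧ x j = 0) := by
    rintro i j hij ⟨z, hz⟩
    have hne : x i ≠ x j := hinj.ne hij
    have hi := hx i
    have hj := hx j
    have hz0 : z ≠ 0 := by rintro rfl; exact hne (by simpa using hz)
    have h1 : (z : ℝ) ≤ 1 := by linarith [hi.2, hj.1]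
    have h2 : (-1 : ℝ) ≤ z := by linarith [hi.1, hj.2]
    have h1' : z ≤ 1 := by exact_mod_cast h1
    have h2' : -1 ≤ z := by exact_mod_cast h2
    obtain rfl | rfl : z = 1 ∨ z = -1 := by omega
    · push_cast at hz
      exact Or.inr ⟨by linarith [hi.2, hj.1], by linarith [hi.2, hj.1]⟩
    · push_cast at hz
      exact Or.inl ⟨by linarith [hi.1, hj.2], by linarith [hi.1, hj.2]⟩
  have hσ : Irrational σ := by
    rintro ⟨r, rfl⟩
    have hint : ∀ k : ℕ, ∃ z : ℤ, x (k * r.den) = x 0 + z := by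
      intro k
      obtain ⟨z, hz⟩ := h (k * r.den)
      obtain ⟨w, hw⟩ := h 0
      refine ⟨k * r.num + z - w, ?_⟩
      have hr : ((r.den : ℝ)) * (r : ℝ) = r.num := by exact_mod_cast Rat.den_mul_eq_num r
      rw [hz, hw]
      push_cast
      rw [mul_assoc, hr]
      ring
    have hd := r.den_pos
    have h1 := hends (1 * r.den) 0 (by omega) (hint 1)
    have h2 := hends (2 * r.den) 0 (by omega) (hint 2)
    have h3 : x (1 * r.den) ≠ x (2 * r.den) := hinj.ne (by omega)
    rcases h1 with h1 | h1 <;> rcases h2 with h2 | h2 <;> apply h3 <;> linarith [h1.1, h1.2, h2.1, h2.2]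
  refine ⟨σ, ρ, hσ, ?_⟩
  by_cases hone : ∃ i, x i = 1
  · right
    obtain ⟨i, hi⟩ := hone
    have hpos : ∀ j, 0 < x j := by
      refine fun j => lt_of_le_of_ne (hx j).1 fun h0 => ?_
      obtain ⟨z, hz⟩ := h i
      obtain ⟨w, hw⟩ := h j
      have hij : i = j := by
        refine rotation_injective hσ ρ (1 - z + w) ?_
        push_cast
        linarith
      rw [hij, ← h0] at hi
      exact zero_ne_one hi
    have heq : x = fun n : ℕ => upperFract (ρ + n * σ) := by
      funext n
      obtain ⟨z, hz⟩ := h n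
      have hc : ⌈ρ + n * σ⌉ = 1 - z := by
        rw [Int.ceil_eq_iff]
        push_cast
        constructor <;> linarith [hpos n, (hx n).2]
      rw [upperFract, hc, hz]
      push_cast
      ring
    subst heq
    rfl
  · left
    push Not at hone
    have heq : x = fun n : ℕ => Int.fract (ρ + n * σ) := by
      funext n
      obtain ⟨z, hz⟩ := h n
      refine (Int.fract_eq_iff.2 ⟨(hx n).1, lt_of_le_of_ne (hx n).2 (hone n), -z, ?_⟩).symm
      push_cast
      linarith
    subst heq
    rfl

end InfinitePermutation

/-! ### Equidistribution of irrational rotations -/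

theorem fract_sub_eq (x z : ℝ) : Int.fract (x - z) =
    Int.fract x - Int.fract z + if Int.fract x < Int.fract z then 1 else 0 := by
  rw [Int.fract_eq_iff]
  have h1 := Int.fract_nonneg x
  have h2 := Int.fract_lt_one x
  have h3 := Int.fract_nonneg z
  have h4 := Int.fract_lt_one z
  have h5 := Int.floor_add_fract x
  have h6 := Int.floor_add_fract z
  split_ifs with h
  · refine ⟨by linarith, by linarith, ⌊x⌋ - ⌊z⌋ - 1, ?_⟩
    push_cast
    linarith
  · refine ⟨by linarith, by linarith, ⌊x⌋ - ⌊z⌋, ?_⟩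
    push_cast
    linarith

theorem exists_fract_mul_mem_Ioo {σ : ℝ} (hσ : Irrational σ) {s t : ℝ} (hs : 0 ≤ s) (hst : s < t)
    (ht : t ≤ 1) : ∃ k : ℤ, Int.fract (k * σ) ∈ Set.Ioo s t := by
  have hd : Dense (AddSubgroup.closure {σ, 1} : Set ℝ) :=
    dense_addSubgroupClosure_pair_iff.2 (by rwa [div_one])
  obtain ⟨y, hy, hy'⟩ := hd.exists_mem_open isOpen_Ioo (Set.nonempty_Ioo.2 hst)
  obtain ⟨k, l, rfl⟩ := AddSubgroup.mem_closure_pair.1 hy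
  refine ⟨k, ?_⟩
  have : Int.fract (k * σ) = k • σ + l • (1 : ℝ) := by
    rw [Int.fract_eq_iff]
    refine ⟨hs.trans hy'.1.le, hy'.2.trans_le ht, -l, ?_⟩
    simp
  rwa [this]

/-- The intervals `[0, {kσ})` have bounded discrepancy: their indicator function is, up to a
constant, the difference of the fractional part function and its translate by `kσ`. -/
theorem exists_bounded_discrepancy (σ ρ : ℝ) (k : ℤ) : ∃ C : ℝ, ∀ n : ℕ,
    |(((Finset.range n).filter fun i : ℕ => Int.fract (ρ + i * σ) < Int.fract (k * σ)).card : ℝ) -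
      n * Int.fract (k * σ)| ≤ C := by
  set F : ℤ → ℝ := fun i => Int.fract (ρ + i * σ) with hF
  have hF0 : ∀ i, 0 ≤ F i := fun i => Int.fract_nonneg _
  have hF1 : ∀ i, F i ≤ 1 := fun i => (Int.fract_lt_one _).le
  have hstep : ∀ (k : ℤ) (n : ℕ), |∑ i ∈ Finset.range n, (F (i + k + 1) - F (i + k))| ≤ 1 := by
    intro k n
    have h := Finset.sum_range_sub (fun i : ℕ => F (i + k)) n
    have h' : ∑ i ∈ Finset.range n, (F (i + k + 1) - F (i + k)) = F (n + k) - F (0 + k) := by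
      rw [← Nat.cast_zero (R := ℤ), ← h]
      refine Finset.sum_congr rfl fun i _ => ?_
      rw [show ((i : ℤ) + k + 1) = ((i + 1 : ℕ) : ℤ) + k by push_cast; ring]
    rw [h', abs_le]
    constructor <;> linarith [hF0 (n + k), hF1 (n + k), hF0 (0 + k), hF1 (0 + k)]
  have hbdd : ∀ k : ℤ, ∃ C : ℝ, ∀ n : ℕ, |∑ i ∈ Finset.range n, (F (i + k) - F i)| ≤ C := by
    intro k
    induction k using Int.induction_on with
    | zero => exact ⟨0, fun n => by simp⟩
    | succ k ih =>
      obtain ⟨C, hC⟩ := ih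
      refine ⟨1 + C, fun n => ?_⟩
      have : ∑ i ∈ Finset.range n, (F (i + (k + 1)) - F i) =
          ∑ i ∈ Finset.range n, (F (i + k + 1) - F (i + k)) +
            ∑ i ∈ Finset.range n, (F (i + k) - F i) := by
        rw [← Finset.sum_add_distrib]
        refine Finset.sum_congr rfl fun i _ => ?_
        rw [← add_assoc]
        ring
      rw [this]
      exact (abs_add_le _ _).trans (add_le_add (hstep _ n) (hC n))
    | pred k ih =>
      obtain ⟨C, hC⟩ := ih
      refine ⟨C + 1, fun n => ?_⟩
      have : ∑ i ∈ Finset.range n, (F (i + (-k - 1)) - F i) =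
          ∑ i ∈ Finset.range n, (F (i + -k) - F i) -
            ∑ i ∈ Finset.range n, (F (i + (-k - 1) + 1) - F (i + (-k - 1))) := by
        rw [← Finset.sum_sub_distrib]
        refine Finset.sum_congr rfl fun i _ => ?_
        rw [show (i : ℤ) + (-k - 1) + 1 = i + -k by ring]
        ring
      rw [this]
      exact (abs_sub _ _).trans (add_le_add (hC n) (hstep _ n))
  obtain ⟨C, hC⟩ := hbdd (-k)
  refine ⟨C, fun n => ?_⟩
  convert hC n using 2
  have hconst : (n : ℝ) * Int.fract (k * σ) = ∑ i ∈ Finset.range n, Int.fract (k * σ) := by simp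
  rw [← Finset.sum_boole, hconst, ← Finset.sum_sub_distrib]
  refine Finset.sum_congr rfl fun i _ => ?_
  have h := fract_sub_eq (ρ + i * σ) (k * σ)
  have h' : F (i + -k) = Int.fract (ρ + i * σ - k * σ) := by
    simp only [hF]
    congr 1
    push_cast
    ring
  rw [h', h]
  simp only [hF, Int.cast_natCast]
  ring

theorem isEquidistributedSeq_fract {σ : ℝ} (hσ : Irrational σ) (ρ : ℝ) :
    IsEquidistributedSeq 0 1 fun n : ℕ => Int.fract (ρ + n * σ) := by
  refine ⟨fun i => ⟨Int.fract_nonneg _, (Int.fract_lt_one _).le⟩, fun t ht => ?_⟩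
  rw [sub_zero, sub_zero, div_one]
  set N : ℝ → ℕ → ℝ := fun t n =>
    (((Finset.range n).filter fun i : ℕ => Int.fract (ρ + i * σ) < t).card : ℝ) / n with hN
  change Tendsto (N t) atTop (𝓝 t)
  have hk : ∀ k : ℤ, Tendsto (N (Int.fract (k * σ))) atTop (𝓝 (Int.fract (k * σ))) := by
    intro k
    obtain ⟨C, hC⟩ := exists_bounded_discrepancy σ ρ k
    rw [tendsto_iff_dist_tendsto_zero]
    refine squeeze_zero' (Eventually.of_forall fun n => dist_nonneg) ?_
      (tendsto_const_div_atTop_nhds_zero_nat C)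
    filter_upwards [eventually_gt_atTop 0] with n hn
    have hn' : (0 : ℝ) < n := by exact_mod_cast hn
    have hdiv : N (Int.fract (k * σ)) n - Int.fract (k * σ) =
        ((((Finset.range n).filter fun i : ℕ => Int.fract (ρ + i * σ) < Int.fract (k * σ)).card : ℝ)
          - n * Int.fract (k * σ)) / n := by
      rw [sub_div, mul_div_cancel_left₀ _ hn'.ne']
    rw [Real.dist_eq, hdiv, abs_div, abs_of_pos hn']
    exact div_le_div_of_nonneg_right (hC n) hn'.le
  have hmono : ∀ n, Monotone fun t => N t n := by
    intro n s t hst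
    refine div_le_div_of_nonneg_right ?_ (Nat.cast_nonneg n)
    exact_mod_cast Finset.card_le_card
      (Finset.monotone_filter_right _ fun i _ hi => lt_of_lt_of_le hi hst)
  have h0 : ∀ n, 0 ≤ N t n := fun n => by positivity
  have h1 : ∀ n, N t n ≤ 1 := fun n => by
    refine div_le_one_of_le₀ ?_ (Nat.cast_nonneg n)
    exact_mod_cast (Finset.card_filter_le _ _).trans (Finset.card_range n).le
  rw [tendsto_order]
  constructor
  · intro b hb
    rcases ht.1.eq_or_lt with rfl | hpos
    · exact Eventually.of_forall fun n => hb.trans_le (h0 n)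
    obtain ⟨k, hk1, hk2⟩ := exists_fract_mul_mem_Ioo hσ (le_max_right b 0) (max_lt hb hpos) ht.2
    filter_upwards [(hk k).eventually (lt_mem_nhds ((le_max_left b 0).trans_lt hk1))] with n hn
    exact hn.trans_le (hmono n hk2.le)
  · intro b hb
    rcases ht.2.eq_or_lt with rfl | hlt
    · exact Eventually.of_forall fun n => (h1 n).trans_lt hb
    obtain ⟨k, hk1, hk2⟩ := exists_fract_mul_mem_Ioo hσ ht.1 (lt_min hb hlt) (min_le_right b 1)
    filter_upwards [(hk k).eventually (gt_mem_nhds (hk2.trans_le (min_le_left b 1)))] with n hn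
    exact (hmono n hk1.le).trans_lt hn

theorem IsEquidistributedSeq.one_sub {x : ℕ → ℝ} (hx : IsEquidistributedSeq 0 1 x)
    (hinj : Function.Injective x) : IsEquidistributedSeq 0 1 fun n => 1 - x n := by
  refine ⟨fun i => ⟨by linarith [(hx.1 i).2], by linarith [(hx.1 i).1]⟩, fun t ht => ?_⟩
  have h1 := hx.2 (1 - t) ⟨by linarith [ht.2], by linarith [ht.1]⟩
  -- The values equal to `1 - t`, counted by neither inequality, do not affect the frequency.
  have h2 : Tendsto (fun n : ℕ => (((Finset.range n).filter fun i => x i = 1 - t).card : ℝ) / n)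
      atTop (𝓝 0) := by
    refine squeeze_zero (fun n => by positivity) (fun n => ?_) tendsto_one_div_atTop_nhds_zero_nat
    refine div_le_div_of_nonneg_right ?_ (Nat.cast_nonneg n)
    have : ((Finset.range n).filter fun i => x i = 1 - t).card ≤ 1 :=
      Finset.card_le_one.2 fun i hi j hj => hinj
        ((Finset.mem_filter.1 hi).2.trans (Finset.mem_filter.1 hj).2.symm)
    exact_mod_cast this
  have h3 := ((tendsto_const_nhds (x := (1 : ℝ))).sub h1).sub h2
  simp only [sub_zero, div_one, sub_sub_cancel] at h3 ⊢
  refine h3.congr' ?_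
  filter_upwards [eventually_gt_atTop 0] with n hn
  have hn' : (n : ℝ) ≠ 0 := by positivity
  have hsum : (((Finset.range n).filter fun i => 1 - x i < t).card : ℝ) +
      ((Finset.range n).filter fun i => x i < 1 - t).card +
        ((Finset.range n).filter fun i => x i = 1 - t).card = n := by
    simp only [← Finset.sum_boole]
    rw [← Finset.sum_add_distrib, ← Finset.sum_add_distrib]
    rw [Finset.sum_congr rfl (g := fun _ => (1 : ℝ)) fun i _ => ?_]
    · simp
    · rcases lt_trichotomy (x i) (1 - t) with h | h | h
      · simp [h, h.ne, show ¬(1 - x i < t) by linarith]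
      · simp [h]
      · simp [h.not_gt, h.ne', show 1 - x i < t by linarith]
  field_simp
  linarith

/-! ### Complexity of rotations -/

/-- For irrational `σ`, the number of the `n` points `{-jσ}`, `j < n`, in `(0, {ρ + iσ}]`. These points cut the circle
into `n` arcs, and this number tells in which of them `{ρ + iσ}` lies. -/
noncomputable def rotationArc (σ ρ : ℝ) (n i : ℕ) : ℕ :=
  ((Finset.range n).filter fun j : ℕ =>
    j ≠ 0 ∧ Int.fract (-(j * σ)) ≤ Int.fract (ρ + i * σ)).card

theorem rotationArc_lt (σ ρ : ℝ) {n : ℕ} (hn : 1 ≤ n) (i : ℕ) : rotationArc σ ρ n i < n := by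
  have h : rotationArc σ ρ n i < (Finset.range n).card :=
    Finset.card_lt_card (Finset.filter_ssubset.2 ⟨0, Finset.mem_range.2 hn, fun h => h.1 rfl⟩)
  rwa [Finset.card_range] at h

theorem sameOrder_of_rotationArc_eq {σ ρ : ℝ} {n i j : ℕ}
    (h : rotationArc σ ρ n i = rotationArc σ ρ n j) :
    SameOrder (fun n : ℕ => Int.fract (ρ + n * σ)) n i j := by
  wlog hle : Int.fract (ρ + i * σ) ≤ Int.fract (ρ + j * σ) generalizing i j
  · exact (this h.symm (le_of_not_ge hle)).symm
  have hset := Finset.eq_of_subset_of_card_le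
    (Finset.monotone_filter_right (Finset.range n) fun k _
      (hk : k ≠ 0 ∧ Int.fract (-((k : ℝ) * σ)) ≤ Int.fract (ρ + i * σ)) =>
      (⟨hk.1, hk.2.trans hle⟩ : k ≠ 0 ∧ Int.fract (-((k : ℝ) * σ)) ≤ Int.fract (ρ + j * σ))) h.ge
  have hiff : ∀ p < n, Int.fract (ρ + i * σ) < Int.fract (-(p * σ)) ↔
      Int.fract (ρ + j * σ) < Int.fract (-(p * σ)) := by
    intro p hp
    rcases Nat.eq_zero_or_pos p with rfl | hp0
    · simp [(Int.fract_nonneg _).not_gt]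
    have := Finset.ext_iff.1 hset p
    simp only [Finset.mem_filter, Finset.mem_range, hp, hp0.ne', true_and, ne_eq,
      not_false_eq_true] at this
    rw [← not_le, ← not_le, this]
  have hval : ∀ p < n, Int.fract (ρ + (i + p : ℕ) * σ) - Int.fract (ρ + i * σ) =
      Int.fract (ρ + (j + p : ℕ) * σ) - Int.fract (ρ + j * σ) := by
    intro p hp
    have h1 : ∀ i : ℕ, ρ + (i + p : ℕ) * σ = ρ + i * σ - -(p * σ) := fun i => by
      push_cast
      ring
    rw [h1, h1, fract_sub_eq, fract_sub_eq]
    simp only [hiff p hp]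
    ring
  intro p hp q hq
  have h1 := hval p hp
  have h2 := hval q hq
  constructor <;> intro h3 <;> dsimp only at h3 ⊢ <;> linarith

namespace InfinitePermutation

theorem upperFract_rotation_eq (σ ρ : ℝ) :
    (fun n : ℕ => upperFract (ρ + n * σ)) = fun n : ℕ => 1 - Int.fract (-ρ + n * -σ) := by
  funext n
  rw [show -ρ + n * -σ = -(ρ + n * σ) by ring, upperFract, Int.fract, Int.floor_neg]
  push_cast
  ring

theorem isEquidistributed_lowerRotation (σ ρ : ℝ) (hσ : Irrational σ) :
    (lowerRotation σ ρ hσ).IsEquidistributed :=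
  ⟨_, ⟨_, rfl⟩, isEquidistributedSeq_fract hσ ρ⟩

theorem isEquidistributed_upperRotation (σ ρ : ℝ) (hσ : Irrational σ) :
    (upperRotation σ ρ hσ).IsEquidistributed := by
  refine ⟨_, ⟨upperFract_rotation_injective hσ ρ, rfl⟩, ?_⟩
  rw [upperFract_rotation_eq]
  exact (isEquidistributedSeq_fract hσ.neg (-ρ)).one_sub (fract_rotation_injective hσ.neg (-ρ))

theorem complexity_lowerRotation_le (σ ρ : ℝ) (hσ : Irrational σ) {n : ℕ} (hn : 1 ≤ n) :
    (lowerRotation σ ρ hσ).complexity n ≤ n :=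
  complexity_mk_le _ (rotationArc σ ρ n) (rotationArc_lt σ ρ hn)
    fun _ _ => sameOrder_of_rotationArc_eq

theorem complexity_upperRotation_le (σ ρ : ℝ) (hσ : Irrational σ) {n : ℕ} (hn : 1 ≤ n) :
    (upperRotation σ ρ hσ).complexity n ≤ n := by
  refine complexity_mk_le _ (rotationArc (-σ) (-ρ) n) (rotationArc_lt _ _ hn) fun i j h => ?_
  rw [upperFract_rotation_eq]
  intro p hp q hq
  simp only [sub_lt_sub_iff_left]
  exact sameOrder_of_rotationArc_eq h q hq p hp

theorem IsEquidistributed.le_complexity {α : InfinitePermutation} (h : α.IsEquidistributed)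
    (n : ℕ) : n ≤ α.complexity n := by
  obtain ⟨a, ⟨ha, rfl⟩, hx⟩ := h
  exact le_complexity_mk ha hx.noMonotoneChain n

theorem IsSturmian.isEquidistributed_and_complexity_eq {α : InfinitePermutation}
    (h : α.IsSturmian) : α.IsEquidistributed ∧ ∀ n : ℕ, 1 ≤ n → α.complexity n = n := by
  obtain ⟨σ, ρ, hσ, rfl | rfl⟩ := h
  · have he := isEquidistributed_lowerRotation σ ρ hσ
    exact ⟨he, fun n hn => (complexity_lowerRotation_le σ ρ hσ hn).antisymm (he.le_complexity n)⟩
  · have he := isEquidistributed_upperRotation σ ρ hσ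
    exact ⟨he, fun n hn => (complexity_upperRotation_le σ ρ hσ hn).antisymm (he.le_complexity n)⟩

theorem IsEquidistributed.isSturmian {α : InfinitePermutation} (h : α.IsEquidistributed)
    (hα : ∀ n : ℕ, 1 ≤ n → α.complexity n = n) : α.IsSturmian := by
  obtain ⟨a, ⟨ha, rfl⟩, hx⟩ := h
  exact isSturmian_mk ha hx.1
    (hx.exists_eq_rotation (isMinimal_of_complexity_eq ha hx.noMonotoneChain hα))

end InfinitePermutation

theorem theorem1 :
    (∀ α : InfinitePermutation, α.IsEquidistributed → ∀ n : ℕ, n ≤ α.complexity n) ∧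
    (∃ α : InfinitePermutation, α.IsEquidistributed ∧ ∀ n : ℕ, 1 ≤ n → α.complexity n = n) ∧
    {α : InfinitePermutation | α.IsEquidistributed ∧ ∀ n : ℕ, 1 ≤ n → α.complexity n = n} =
      {α : InfinitePermutation | α.IsSturmian} := by
  refine ⟨fun α h n => h.le_complexity n, ?_, ?_⟩
  · have h : (InfinitePermutation.lowerRotation (√2) 0 irrational_sqrt_two).IsSturmian :=
      ⟨_, _, _, Or.inl rfl⟩
    exact ⟨_, h.isEquidistributed_and_complexity_eq⟩
  · ext α
    exact ⟨fun h => h.1.isSturmian h.2, fun h => h.isEquidistributed_and_complexity_eq⟩
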